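/- A tree is a partially ordered set $(T,\preceq)$ such that for each $t\in T$ the set $b_t=\{s\in T: s\preceq t\}$ is finite and linearly ordered; its initial nodes are its minimal elements. A branch of $T$ is a non-empty linearly ordered subset of $T$ that is closed under taking direct predecessors. The set of all branches is denoted $[T]$ and carries the tree topology, generated by the sets $U_t=\{b\in[T]: t\in b\}$ and $[T]\setminus U_t$, $t\in T$; the space $[T]$ is compact if $T$ has finitely many initial nodes. The tree $T$ is well-founded if it has no infinite branches; then $[T]=\{b_t: t\in T\}$ is identified with $T$, and one writes $C(T)$ for $C([T])$. For a compact space $K$, $C(K)$ is the Banach space of continuous real-valued functions on $K$ with the supremum norm. A Banach space is an Asplund space if each of its separable subspaces has separable dual. Let $T$ be a tree with finitely many initial nodes. If $T$ is well-founded, then $C(T)$ is an Asplund space. Conversely, if $C([T])$ is an Asplund space, then there is a well-founded tree $S$ with finitely many initial nodes such that $[S]$ (that is, $S$ with its tree topology) is homeomorphic to $[T]$. -/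

import Mathlib

open Set

universe u

/-- A tree: a partially ordered set in which the set `b_t = {s | s ≤ t}` of predecessors of each
element `t` is finite and linearly ordered. -/
class IsOrderTree (T : Type u) [PartialOrder T] : Prop where
  finite_Iic : ∀ t : T, (Iic t).Finite
  isChain_Iic : ∀ t : T, IsChain (· ≤ ·) (Iic t)

/-- The initial nodes of a tree: its minimal elements. -/
def InitialNode (T : Type u) [PartialOrder T] : Type u := {t : T // IsMin t}

/-- A branch: a non-empty, linearly ordered subset which is closed under taking direct
predecessors. -/
structure IsBranch {T : Type u} [PartialOrder T] (b : Set T) : Prop where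
  nonempty : b.Nonempty
  isChain : IsChain (· ≤ ·) b
  directPred_mem : ∀ ⦃s t : T⦄, s ⋖ t → t ∈ b → s ∈ b

/-- The tree space `[T]`: the set of all branches of `T`. The element `t` of `T` is identified with
the finite branch `{s | s ≤ t}`; the infinite branches form the boundary of `T`. -/
def TreeSpace (T : Type u) [PartialOrder T] : Type u := {b : Set T // IsBranch b}

namespace TreeSpace

/-- `U_t`, the set of all branches that contain `t`. -/
def cone {T : Type u} [PartialOrder T] (t : T) : Set (TreeSpace T) := {b | t ∈ b.1}

/-- The tree topology, generated by the sets `U_t` and their complements. -/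
instance {T : Type u} [PartialOrder T] : TopologicalSpace (TreeSpace T) :=
  TopologicalSpace.generateFrom {V | ∃ t : T, V = cone t ∨ V = (cone t)ᶜ}

/-- Every branch contains an initial node. -/
theorem exists_isMin_mem {T : Type u} [PartialOrder T] [IsOrderTree T] (b : TreeSpace T) :
    ∃ t : T, IsMin t ∧ t ∈ b.1 := by
  obtain ⟨t₀, ht₀⟩ := b.2.nonempty
  have hfin : (b.1 ∩ Iic t₀).Finite := (IsOrderTree.finite_Iic t₀).inter_of_right _
  obtain ⟨t, ht⟩ := hfin.exists_minimal ⟨t₀, ht₀, le_refl t₀⟩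
  refine ⟨t, ?_, ht.prop.1⟩
  by_contra hmin
  rw [not_isMin_iff] at hmin
  obtain ⟨r, hr⟩ := hmin
  have hfin' : (Iio t).Finite := (IsOrderTree.finite_Iic t).subset Iio_subset_Iic_self
  obtain ⟨s, hs⟩ := hfin'.exists_maximal ⟨r, hr⟩
  have hcov : s ⋖ t := ⟨hs.prop, fun c hsc hct => hs.not_gt hct hsc⟩
  exact ht.not_lt ⟨b.2.directPred_mem hcov ht.prop.1, hcov.le.trans ht.prop.2⟩ hcov.lt

/-- The tree space of a tree with finitely many initial nodes is compact; this is what makes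
`C(TreeSpace T, ℝ)` a normed space. -/
instance {T : Type u} [PartialOrder T] [IsOrderTree T] [Finite (InitialNode T)] :
    CompactSpace (TreeSpace T) := by
  refine ⟨isCompact_iff_ultrafilter_le_nhds.2 fun F _ => ?_⟩
  have hne : ∃ t : T, cone t ∈ F := by
    have hcov : (⋃ t : InitialNode T, cone t.1) ∈ F := by
      refine Filter.mem_of_superset (Filter.univ_mem (f := (F : Filter (TreeSpace T)))) fun b _ => ?_
      obtain ⟨t, ht, htb⟩ := exists_isMin_mem b
      exact mem_iUnion.2 ⟨⟨t, ht⟩, htb⟩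
    rw [← sUnion_range, Ultrafilter.finite_sUnion_mem_iff (finite_range _)] at hcov
    obtain ⟨_, ⟨t, rfl⟩, ht⟩ := hcov
    exact ⟨t.1, ht⟩
  let b : TreeSpace T := ⟨{t | cone t ∈ F}, hne, ?_, ?_⟩
  · refine ⟨b, mem_univ _, ?_⟩
    rw [TopologicalSpace.nhds_generateFrom]
    refine le_iInf₂ fun V hV => Filter.le_principal_iff.2 ?_
    obtain ⟨hbV, t, rfl | rfl⟩ := hV
    · exact hbV
    · exact Ultrafilter.compl_mem_iff_notMem.2 hbV
  · intro s hs t ht hst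
    obtain ⟨c, hcs, hct⟩ := F.nonempty_of_mem (Filter.inter_mem hs ht)
    exact c.2.isChain hcs hct hst
  · intro s t hst ht
    exact Filter.mem_of_superset ht fun c hc => c.2.directPred_mem hst hc

end TreeSpace

/-- A tree is well-founded if it has no infinite branches. -/
def IsWellFoundedTree (T : Type u) [PartialOrder T] : Prop :=
  ∀ b : TreeSpace T, b.1.Finite

/-- An Asplund space: every separable subspace has separable (norm) dual. -/
def IsAsplundSpace (X : Type u) [NormedAddCommGroup X] [NormedSpace ℝ X] : Prop :=
  ∀ Y : Submodule ℝ X, TopologicalSpace.SeparableSpace Y →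
    TopologicalSpace.SeparableSpace (StrongDual ℝ Y)

/-! Well-founded implies Asplund: point evaluations have dense span in the dual of `C(T)`
(`evalSpan_eq_top`), and on a separable subspace they take only countably many values
(`countable_evalCLM_comp_subtypeL_image`). Functionals on the subspace extend by Hahn–Banach, so its
dual is separable. Both facts climb from the children of a node `t` to `t` by well-founded
induction. The engine is that a neighbourhood of `b_t` contains the cone of `t` minus finitely many
child cones.

Converse: call a set of branches good if it satisfies `AdmitsTreeOrder`, bad otherwise. If `[T]` is
good, compactness makes the new tree well-founded, with `[T]` as its tree space
(`exists_homeomorph`). If `[T]` is bad, some cone is bad, and every bad cone contains two disjoint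
bad cones: otherwise the bad nodes form a chain, and the good pieces split off along it reassemble
into a good cone. This yields a dyadic scheme of cones, whose countably many indicators separate
continuum many branches; their span is separable with non-separable dual. -/

section OrderTree

variable {T : Type u} [PartialOrder T]

/-! ### Order-theoretic preliminaries on trees -/

theorem IsOrderTree.exists_covBy_le [IsOrderTree T] {s t : T} (h : s < t) : ∃ c, s ⋖ c ∧ c ≤ t := by
  have hfin : (Ioc s t).Finite := (IsOrderTree.finite_Iic t).subset fun x hx => hx.2
  obtain ⟨c, hc⟩ := hfin.exists_minimal ⟨t, h, le_rfl⟩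
  exact ⟨c, ⟨hc.prop.1, fun d hsd hdc => hc.not_lt ⟨hsd, hdc.le.trans hc.prop.2⟩ hdc⟩, hc.prop.2⟩

theorem IsOrderTree.exists_le_covBy [IsOrderTree T] {s t : T} (h : s < t) : ∃ c, s ≤ c ∧ c ⋖ t := by
  have hfin : (Ico s t).Finite := (IsOrderTree.finite_Iic t).subset fun x hx => hx.2.le
  obtain ⟨c, hc⟩ := hfin.exists_maximal ⟨s, le_rfl, h⟩
  exact ⟨c, hc.prop.1, ⟨hc.prop.2, fun d hcd hdt => hc.not_gt ⟨hc.prop.1.trans hcd.le, hdt⟩ hcd⟩⟩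

theorem IsOrderTree.wellFounded_lt [IsOrderTree T] : WellFounded ((· < ·) : T → T → Prop) := by
  refine WellFounded.wellFounded_iff_has_min.2 fun s ⟨t, ht⟩ => ?_
  have hfin : (s ∩ Iic t).Finite := (IsOrderTree.finite_Iic t).inter_of_right _
  obtain ⟨m, hm⟩ := hfin.exists_minimal ⟨t, ht, le_rfl⟩
  exact ⟨m, hm.prop.1, fun x hx hxm => hm.not_lt ⟨hx, hxm.le.trans hm.prop.2⟩ hxm⟩

theorem IsOrderTree.le_total_of_le [IsOrderTree T] {r s t : T} (hr : r ≤ t) (hs : s ≤ t) :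
    r ≤ s ∨ s ≤ r :=
  (IsOrderTree.isChain_Iic t).total hr hs

theorem IsBranch.mem_of_le [IsOrderTree T] {b : Set T} (hb : IsBranch b) {s t : T} (hst : s ≤ t)
    (ht : t ∈ b) : s ∈ b := by
  revert hst ht
  refine IsOrderTree.wellFounded_lt.induction (C := fun t => s ≤ t → t ∈ b → s ∈ b) t
    fun t ih hst ht => ?_
  obtain rfl | hlt := hst.eq_or_lt
  · exact ht
  · obtain ⟨c, hsc, hct⟩ := IsOrderTree.exists_le_covBy hlt
    exact ih c hct.lt hsc (hb.directPred_mem hct ht)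

theorem isBranch_Iic [IsOrderTree T] (t : T) : IsBranch (Iic t) :=
  ⟨⟨t, le_rfl⟩, IsOrderTree.isChain_Iic t, fun _ _ h ht => h.le.trans ht⟩

theorem isBranch_of_monotone [IsOrderTree T] {f : ℕ → T} (hf : Monotone f) :
    IsBranch {s | ∃ n, s ≤ f n} := by
  refine ⟨⟨f 0, 0, le_rfl⟩, ?_, fun s t hst ⟨n, hn⟩ => ⟨n, hst.le.trans hn⟩⟩
  rintro r ⟨m, hm⟩ s ⟨n, hn⟩ -
  exact IsOrderTree.le_total_of_le (hm.trans (hf (le_max_left m n)))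
    (hn.trans (hf (le_max_right m n)))

end OrderTree

/-! ### Cones and the topology of the tree space -/

namespace TreeSpace

variable {T : Type u} [PartialOrder T]

theorem isClopen_cone (t : T) : IsClopen (cone t) :=
  ⟨isOpen_compl_iff.1 (TopologicalSpace.isOpen_generateFrom_of_mem ⟨t, Or.inr rfl⟩),
    TopologicalSpace.isOpen_generateFrom_of_mem ⟨t, Or.inl rfl⟩⟩

instance : T2Space (TreeSpace T) := by
  refine ⟨fun b c hbc => ?_⟩
  have : ∃ t, ¬ (t ∈ b.1 ↔ t ∈ c.1) := by
    by_contra! h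
    exact hbc (Subtype.ext (Set.ext h))
  obtain ⟨t, ht⟩ := this
  by_cases htb : t ∈ b.1
  · exact ⟨cone t, (cone t)ᶜ, (isClopen_cone t).2, (isClopen_cone t).compl.2, htb,
      fun hc => ht ⟨fun _ => hc, fun _ => htb⟩, disjoint_compl_right⟩
  · exact ⟨(cone t)ᶜ, cone t, (isClopen_cone t).compl.2, (isClopen_cone t).2, htb,
      by_contra fun hc => ht ⟨fun h => absurd h htb, fun h => absurd h hc⟩, disjoint_compl_left⟩

theorem disjoint_cone {s t : T} (hst : ¬ s ≤ t) (hts : ¬ t ≤ s) : Disjoint (cone s) (cone t) :=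
  disjoint_left.2 fun b hs ht => (b.2.isChain.total hs ht).elim hst hts

theorem disjoint_cone_of_covBy {t c d : T} (hc : t ⋖ c) (hd : t ⋖ d) (hcd : c ≠ d) :
    Disjoint (cone c) (cone d) :=
  disjoint_cone (fun h => hd.2 hc.lt (h.lt_of_ne hcd)) fun h => hc.2 hd.lt (h.lt_of_ne hcd.symm)

variable [IsOrderTree T]

theorem cone_anti {s t : T} (h : s ≤ t) : cone t ⊆ cone s := fun b hb => b.2.mem_of_le h hb

/-- The finite branch `b_t`. -/
def ofNode (t : T) : TreeSpace T := ⟨Iic t, isBranch_Iic t⟩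

theorem ofNode_mem_cone (t : T) : ofNode t ∈ cone t := le_refl t

theorem ofNode_notMem_cone {s t : T} (h : s < t) : ofNode s ∉ cone t := fun h' => h.not_ge h'

theorem eq_ofNode_or_mem_cone {t : T} {b : TreeSpace T} (hb : b ∈ cone t) :
    b = ofNode t ∨ ∃ c : {c // t ⋖ c}, b ∈ cone c.1 := by
  by_cases h : ∃ s ∈ b.1, t < s
  · obtain ⟨s, hs, hts⟩ := h
    obtain ⟨c, hc, hcs⟩ := IsOrderTree.exists_covBy_le hts
    exact Or.inr ⟨⟨c, hc⟩, b.2.mem_of_le hcs hs⟩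
  · refine Or.inl (Subtype.ext (Set.ext fun s => ⟨fun hs => ?_, fun hs => b.2.mem_of_le hs hb⟩))
    obtain h' | h' := b.2.isChain.total hs hb
    · exact h'
    · exact (h'.eq_or_lt.resolve_right fun hlt => h ⟨s, hs, hlt⟩).ge

/-- Compactness: off `ofNode t`, the cone of `t` is covered by its open child cones, so finitely
many of them cover the compact part lying outside `W`. -/
theorem exists_finset_cone_diff_subset [Finite (InitialNode T)] {t : T} {W : Set (TreeSpace T)}
    (hW : IsOpen W) (ht : ofNode t ∈ W) :
    ∃ F : Finset {c // t ⋖ c}, ∀ b ∈ cone t, (∀ c ∈ F, b ∉ cone c.1) → b ∈ W := by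
  have hcomp : IsCompact (cone t \ W) := ((isClopen_cone t).1.sdiff hW).isCompact
  obtain ⟨F, hF⟩ := hcomp.elim_finite_subcover (fun c : {c // t ⋖ c} => cone c.1)
    (fun c => (isClopen_cone c.1).2) (fun b hb => by
      obtain rfl | ⟨c, hc⟩ := eq_ofNode_or_mem_cone hb.1
      · exact absurd ht hb.2
      · exact mem_iUnion.2 ⟨c, hc⟩)
  refine ⟨F, fun b hb hbF => by_contra fun hbW => ?_⟩
  obtain ⟨c, hcF, hc⟩ := mem_iUnion₂.1 (hF ⟨hb, hbW⟩)
  exact hbF c hcF hc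

theorem eq_of_forall_mem {f : ℕ → T} (hf : StrictMono f) {b : TreeSpace T} (hb : ∀ n, f n ∈ b.1) :
    b = ⟨{s | ∃ n, s ≤ f n}, isBranch_of_monotone hf.monotone⟩ := by
  refine Subtype.ext (Set.ext fun s => ⟨fun hs => ?_, fun ⟨n, hn⟩ => b.2.mem_of_le hn (hb n)⟩)
  by_contra h
  refine infinite_of_injective_forall_mem hf.injective (fun n => ?_) (IsOrderTree.finite_Iic s)
  exact (b.2.isChain.total hs (hb n)).resolve_left fun h' => h ⟨n, h'⟩

end TreeSpace

/-- A counterexample always has a counterexample among its direct successors; iterating this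
produces an infinite branch. -/
theorem IsWellFoundedTree.induction {T : Type u} [PartialOrder T] [IsOrderTree T]
    (hT : IsWellFoundedTree T) {P : T → Prop} (h : ∀ t, (∀ c : {c // t ⋖ c}, P c.1) → P t)
    (t : T) : P t := by
  by_contra ht
  have hstep : ∀ s : {s // ¬ P s}, ∃ c : {s // ¬ P s}, s.1 ⋖ c.1 := fun s => by
    by_contra! hs
    exact s.2 (h s.1 fun c => by_contra fun hc => hs ⟨c.1, hc⟩ c.2)
  choose g hg using hstep
  let f : ℕ → {s // ¬ P s} := fun n => g^[n] ⟨t, ht⟩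
  have hf : StrictMono fun n => (f n).1 := strictMono_nat_of_lt_succ fun n => by
    simpa only [f, Function.iterate_succ_apply'] using (hg (f n)).lt
  exact infinite_of_injective_forall_mem hf.injective (s := {s | ∃ n, s ≤ (f n).1}) (fun n => ⟨n, le_rfl⟩)
    (hT ⟨_, isBranch_of_monotone hf.monotone⟩)

/-! ### Functionals on `C(K, ℝ)` restricted to clopen sets -/

section Clopen

variable {K : Type u} [TopologicalSpace K]

/-- The indicator function of a clopen set, as a continuous function. -/
noncomputable def IsClopen.ind {U : Set K} (hU : IsClopen U) : C(K, ℝ) :=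
  ⟨LocallyConstant.charFn ℝ hU, (LocallyConstant.charFn ℝ hU).continuous⟩

theorem IsClopen.ind_of_mem {U : Set K} (hU : IsClopen U) {x : K} (hx : x ∈ U) : hU.ind x = 1 := by
  simp only [IsClopen.ind, ContinuousMap.coe_mk, LocallyConstant.coe_charFn, indicator_of_mem hx,
    Pi.one_apply]

theorem IsClopen.ind_of_notMem {U : Set K} (hU : IsClopen U) {x : K} (hx : x ∉ U) :
    hU.ind x = 0 := by
  simp only [IsClopen.ind, ContinuousMap.coe_mk, LocallyConstant.coe_charFn,
    indicator_of_notMem hx]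

theorem sum_ind_mul_apply_of_mem {ι : Type*} {V : ι → Set K} (hV : ∀ i, IsClopen (V i))
    (hd : ∀ i j, i ≠ j → Disjoint (V i) (V j)) (f : ι → C(K, ℝ)) {F : Finset ι} {i : ι}
    (hi : i ∈ F) {x : K} (hx : x ∈ V i) : (∑ j ∈ F, (hV j).ind * f j) x = f i x := by
  rw [ContinuousMap.sum_apply, Finset.sum_eq_single_of_mem i hi fun j _ hji => ?_,
    ContinuousMap.mul_apply, (hV i).ind_of_mem hx, one_mul]
  rw [ContinuousMap.mul_apply, (hV j).ind_of_notMem (disjoint_right.1 (hd j i hji) hx), zero_mul]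

theorem sum_ind_mul_apply_of_notMem {ι : Type*} {V : ι → Set K} (hV : ∀ i, IsClopen (V i))
    (f : ι → C(K, ℝ)) {F : Finset ι} {x : K} (hx : ∀ i ∈ F, x ∉ V i) :
    (∑ j ∈ F, (hV j).ind * f j) x = 0 := by
  rw [ContinuousMap.sum_apply]
  refine Finset.sum_eq_zero fun j hj => ?_
  rw [ContinuousMap.mul_apply, (hV j).ind_of_notMem (hx j hj), zero_mul]

variable [CompactSpace K]

/-- The restriction of a functional on `C(K, ℝ)` to a clopen subset of `K`. -/
noncomputable def IsClopen.restrictDual {U : Set K} (hU : IsClopen U)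
    (φ : StrongDual ℝ C(K, ℝ)) : StrongDual ℝ C(K, ℝ) :=
  φ.comp (ContinuousLinearMap.mul ℝ C(K, ℝ) hU.ind)

theorem IsClopen.restrictDual_apply {U : Set K} (hU : IsClopen U) (φ : StrongDual ℝ C(K, ℝ))
    (f : C(K, ℝ)) : hU.restrictDual φ f = φ (hU.ind * f) := rfl

/-- Almost norming functions for the single restrictions, cut off to disjoint sets, add up to one
function of norm at most 1. -/
theorem sum_norm_restrictDual_le {ι : Type*} {V : ι → Set K} (hV : ∀ i, IsClopen (V i))
    (hd : ∀ i j, i ≠ j → Disjoint (V i) (V j)) (φ : StrongDual ℝ C(K, ℝ)) (F : Finset ι) :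
    ∑ i ∈ F, ‖(hV i).restrictDual φ‖ ≤ ‖φ‖ := by
  refine le_of_forall_pos_le_add fun η hη => ?_
  -- The `+ 1` keeps the denominator positive when `F` is empty.
  have hpos : (0 : ℝ) < F.card + 1 := by positivity
  have hex : ∀ i, ∃ f : C(K, ℝ), ‖f‖ ≤ 1 ∧
      ‖(hV i).restrictDual φ‖ - η / (F.card + 1) ≤ φ ((hV i).ind * f) := fun i => by
    obtain ⟨f, hf, hlt⟩ := ((hV i).restrictDual φ).exists_lt_apply_of_lt_opNorm
      (sub_lt_self _ (div_pos hη hpos))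
    rw [(hV i).restrictDual_apply, Real.norm_eq_abs] at hlt
    obtain h | h := abs_choice (φ ((hV i).ind * f))
    · exact ⟨f, hf.le, (h ▸ hlt).le⟩
    · refine ⟨-f, by rw [norm_neg]; exact hf.le, ?_⟩
      rw [mul_neg, map_neg]
      exact (h ▸ hlt).le
  choose f hf hlt using hex
  have hnorm : ‖∑ i ∈ F, (hV i).ind * f i‖ ≤ 1 := by
    refine (ContinuousMap.norm_le _ zero_le_one).2 fun x => ?_
    by_cases hx : ∃ i ∈ F, x ∈ V i
    · obtain ⟨i, hi, hx⟩ := hx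
      rw [sum_ind_mul_apply_of_mem hV hd f hi hx]
      exact ((f i).norm_coe_le_norm x).trans (hf i)
    · rw [sum_ind_mul_apply_of_notMem hV f fun i hi hxi => hx ⟨i, hi, hxi⟩, norm_zero]
      exact zero_le_one
  have hsum : ∑ i ∈ F, (‖(hV i).restrictDual φ‖ - η / (F.card + 1)) ≤
      φ (∑ i ∈ F, (hV i).ind * f i) := by
    rw [map_sum]
    exact Finset.sum_le_sum fun i _ => hlt i
  rw [Finset.sum_sub_distrib, Finset.sum_const, nsmul_eq_mul] at hsum
  have hφ : φ (∑ i ∈ F, (hV i).ind * f i) ≤ ‖φ‖ :=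
    (le_abs_self _).trans ((φ.le_opNorm _).trans (mul_le_of_le_one_right (norm_nonneg _) hnorm))
  have hη' : (F.card : ℝ) * (η / (F.card + 1)) ≤ η := by
    rw [mul_div_assoc', div_le_iff₀ hpos]
    nlinarith
  linarith

/-- The closed linear span of the point evaluations in the dual of `C(K, ℝ)`. -/
noncomputable def evalSpan (K : Type u) [TopologicalSpace K] [CompactSpace K] :
    Submodule ℝ (StrongDual ℝ C(K, ℝ)) :=
  (Submodule.span ℝ (range fun x : K => ContinuousMap.evalCLM ℝ x)).topologicalClosure

theorem evalCLM_mem_evalSpan (x : K) : ContinuousMap.evalCLM ℝ x ∈ evalSpan K :=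
  Submodule.le_topologicalClosure _ (Submodule.subset_span ⟨x, rfl⟩)

end Clopen

/-! ### Well-founded trees give Asplund spaces -/

namespace TreeSpace

variable {T : Type u} [PartialOrder T] [IsOrderTree T] [Finite (InitialNode T)]

/-- Finitely many child cones carry all but `ε / 3` of the total norm of `φ` on child cones. What
remains of the cone of `t` acts approximately like a multiple of evaluation at `ofNode t`. -/
theorem restrictDual_mem_evalSpan (φ : StrongDual ℝ C(TreeSpace T, ℝ)) {t : T}
    (h : ∀ c : {c // t ⋖ c}, (isClopen_cone c.1).restrictDual φ ∈ evalSpan (TreeSpace T)) :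
    (isClopen_cone t).restrictDual φ ∈ evalSpan (TreeSpace T) := by
  classical
  have hV : ∀ c : {c // t ⋖ c}, IsClopen (cone c.1) := fun c => isClopen_cone c.1
  have hd : ∀ c d : {c // t ⋖ c}, c ≠ d → Disjoint (cone c.1) (cone d.1) := fun c d hcd =>
    disjoint_cone_of_covBy c.2 d.2 fun h' => hcd (Subtype.ext h')
  have hsum : Summable fun c : {c // t ⋖ c} => ‖(hV c).restrictDual φ‖ :=
    summable_of_sum_le (fun c => norm_nonneg ((hV c).restrictDual φ)) (sum_norm_restrictDual_le hV hd φ)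
  have hclosed : IsClosed (evalSpan (TreeSpace T) : Set (StrongDual ℝ C(TreeSpace T, ℝ))) :=
    Submodule.isClosed_topologicalClosure _
  refine hclosed.closure_subset
    ((Metric.mem_closure_iff (α := StrongDual ℝ C(TreeSpace T, ℝ))).2 fun ε hε => ?_)
  obtain ⟨F, hF⟩ := summable_iff_vanishing_norm.1 hsum (ε / 3) (by positivity)
  -- `A` is the indicator of the cone of `t` without the child cones in `F`; `ψ` concentrates the
  -- mass `φ A` at `ofNode t`.
  let A : C(TreeSpace T, ℝ) := (isClopen_cone t).ind - ∑ c ∈ F, (hV c).ind * 1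
  let ψ : StrongDual ℝ C(TreeSpace T, ℝ) :=
    ∑ c ∈ F, (hV c).restrictDual φ + φ A • ContinuousMap.evalCLM ℝ (ofNode t)
  refine ⟨ψ, add_mem (sum_mem fun c _ => h c) (Submodule.smul_mem _ _ (evalCLM_mem_evalSpan _)), ?_⟩
  refine (dist_eq_norm (E := StrongDual ℝ C(TreeSpace T, ℝ)) _ _).trans_lt ?_
  refine (ContinuousLinearMap.opNorm_le_bound _ (by positivity) fun f => ?_).trans_lt
    (show ε / 3 * 2 < ε by linarith)
  refine le_of_forall_pos_le_add fun η hη => ?_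
  have hη' : 0 < η / (‖φ‖ + 1) := by positivity
  -- `F'` depends on `f`, but costs nothing in the norm estimate: cones in `F' \ F` have total mass
  -- below `ε / 3`, and the rest contributes at most the arbitrary `η`.
  obtain ⟨F', hF'⟩ := exists_finset_cone_diff_subset (t := t)
    (W := {b | |f b - f (ofNode t)| < η / (‖φ‖ + 1)})
    (isOpen_lt (by fun_prop) continuous_const) (by simpa using hη')
  let g : C(TreeSpace T, ℝ) := f - f (ofNode t) • 1
  have hg : ∀ b, g b = f b - f (ofNode t) := fun b => by simp [g]
  have hgnorm : ‖g‖ ≤ 2 * ‖f‖ := by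
    refine (ContinuousMap.norm_le _ (by positivity)).2 fun b => ?_
    rw [hg, two_mul]
    exact (norm_sub_le _ _).trans (add_le_add (f.norm_coe_le_norm _) (f.norm_coe_le_norm _))
  have happly : (isClopen_cone t).restrictDual φ f - ψ f = φ (A * g) := by
    have hAg : A * g = (isClopen_cone t).ind * f - ∑ c ∈ F, (hV c).ind * f -
        f (ofNode t) • A := by
      simp only [A, g, mul_one, ← Finset.sum_mul]
      ext b
      simp only [ContinuousMap.mul_apply, ContinuousMap.sub_apply, ContinuousMap.smul_apply,
        ContinuousMap.one_apply, smul_eq_mul]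
      ring
    rw [hAg, map_sub, map_sub, map_sum, map_smul]
    simp only [ψ, add_apply, sum_apply, smul_apply, IsClopen.restrictDual_apply,
      ContinuousMap.evalCLM_apply, smul_eq_mul]
    ring
  have hsplit : A * g = ∑ c ∈ F' \ F, (hV c).ind * g +
      ((isClopen_cone t).ind - ∑ c ∈ F ∪ F', (hV c).ind * 1) * g := by
    rw [← Finset.sum_sdiff (Finset.subset_union_left (s₁ := F) (s₂ := F')),
      Finset.union_sdiff_left, ← Finset.sum_mul]
    simp only [A, mul_one]
    ring
  have h₁ : |∑ c ∈ F' \ F, φ ((hV c).ind * g)| ≤ ε / 3 * (2 * ‖f‖) := by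
    have hlt : ∑ c ∈ F' \ F, ‖(hV c).restrictDual φ‖ < ε / 3 :=
      (Real.le_norm_self _).trans_lt (hF (F' \ F) Finset.sdiff_disjoint)
    calc |∑ c ∈ F' \ F, φ ((hV c).ind * g)|
        ≤ ∑ c ∈ F' \ F, |φ ((hV c).ind * g)| := Finset.abs_sum_le_sum_abs _ _
      _ ≤ ∑ c ∈ F' \ F, ‖(hV c).restrictDual φ‖ * ‖g‖ :=
        Finset.sum_le_sum fun c _ => ((hV c).restrictDual φ).le_opNorm g
      _ = (∑ c ∈ F' \ F, ‖(hV c).restrictDual φ‖) * ‖g‖ := (Finset.sum_mul _ _ _).symm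
      _ ≤ ε / 3 * (2 * ‖f‖) := by gcongr
  have h₂ : ‖((isClopen_cone t).ind - ∑ c ∈ F ∪ F', (hV c).ind * 1) * g‖ ≤ η / (‖φ‖ + 1) := by
    refine (ContinuousMap.norm_le _ hη'.le).2 fun b => ?_
    rw [ContinuousMap.mul_apply, ContinuousMap.sub_apply]
    by_cases hb : b ∈ cone t
    · rw [IsClopen.ind_of_mem _ hb]
      by_cases hbc : ∃ c ∈ F ∪ F', b ∈ cone c.1
      · obtain ⟨c, hc, hbc⟩ := hbc
        rw [sum_ind_mul_apply_of_mem hV hd _ hc hbc]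
        simpa using hη'.le
      · rw [sum_ind_mul_apply_of_notMem hV _ fun c hc hbc' => hbc ⟨c, hc, hbc'⟩, sub_zero, one_mul,
          hg]
        exact (hF' b hb fun c hc hbc' => hbc ⟨c, Finset.mem_union_right _ hc, hbc'⟩).le
    · rw [IsClopen.ind_of_notMem _ hb, sum_ind_mul_apply_of_notMem hV _ fun c _ hbc =>
        hb (cone_anti c.2.le hbc)]
      simpa using hη'.le
  have h₃ : |φ (((isClopen_cone t).ind - ∑ c ∈ F ∪ F', (hV c).ind * 1) * g)| ≤ η := by
    refine (φ.le_opNorm_of_le h₂).trans ?_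
    rw [mul_div_assoc', div_le_iff₀ (by positivity)]
    nlinarith [norm_nonneg φ]
  rw [sub_apply, happly, hsplit, map_add, map_sum, Real.norm_eq_abs]
  refine (abs_add_le _ _).trans (add_le_add (h₁.trans_eq (by ring)) h₃)

theorem evalSpan_eq_top (hT : IsWellFoundedTree T) : evalSpan (TreeSpace T) = ⊤ := by
  refine (Submodule.eq_top_iff').2 fun φ => ?_
  have hcone := hT.induction
    (P := fun t => (isClopen_cone t).restrictDual φ ∈ evalSpan (TreeSpace T))
    fun t => restrictDual_mem_evalSpan φ
  have := Fintype.ofFinite (InitialNode T)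
  have hV : ∀ t : InitialNode T, IsClopen (cone t.1) := fun t => isClopen_cone t.1
  have hd : ∀ s t : InitialNode T, s ≠ t → Disjoint (cone s.1) (cone t.1) := fun s t hst =>
    disjoint_cone (fun hle => hst (Subtype.ext (t.2.eq_of_le hle)))
      fun hle => hst (Subtype.ext (s.2.eq_of_le hle).symm)
  have heq : φ = ∑ t : InitialNode T, (isClopen_cone t.1).restrictDual φ := by
    ext f
    rw [sum_apply]
    simp only [IsClopen.restrictDual_apply]
    rw [← map_sum]
    congr 1
    ext b
    obtain ⟨t, ht, htb⟩ := exists_isMin_mem b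
    exact (sum_ind_mul_apply_of_mem hV hd (fun _ => f) (Finset.mem_univ ⟨t, ht⟩) htb).symm
  rw [heq]
  exact sum_mem fun t _ => hcone t.1

/-- For each function in a countable dense set and each precision `1 / (n + 1)`, finitely many child
cones are exceptional. A branch of the cone outside these countably many cones evaluates on `Y`
exactly like `ofNode t`. -/
theorem countable_evalCLM_comp_subtypeL_image (Y : Submodule ℝ C(TreeSpace T, ℝ))
    [TopologicalSpace.SeparableSpace Y] {t : T}
    (h : ∀ c : {c // t ⋖ c},
      ((fun b => (ContinuousMap.evalCLM ℝ b).comp Y.subtypeL) '' cone c.1).Countable) :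
    ((fun b => (ContinuousMap.evalCLM ℝ b).comp Y.subtypeL) '' cone t).Countable := by
  obtain ⟨D, hDc, hD⟩ := TopologicalSpace.exists_countable_dense Y
  choose G hG using fun (f : Y) (n : ℕ) => exists_finset_cone_diff_subset (t := t)
    (W := {b | |f.1 b - f.1 (ofNode t)| < 1 / ((n : ℝ) + 1)})
    (isOpen_lt (by fun_prop) continuous_const)
    (by simpa using Nat.cast_add_one_pos n)
  have hC : (⋃ f ∈ D, ⋃ n, (G f n : Set {c // t ⋖ c})).Countable :=
    hDc.biUnion fun f _ => countable_iUnion fun n => (G f n).countable_toSet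
  refine ((hC.biUnion fun c _ => h c).insert
    ((ContinuousMap.evalCLM ℝ (ofNode t)).comp Y.subtypeL)).mono ?_
  rintro _ ⟨b, hb, rfl⟩
  by_cases hbC : ∃ c ∈ ⋃ f ∈ D, ⋃ n, (G f n : Set {c // t ⋖ c}), b ∈ cone c.1
  · obtain ⟨c, hc, hbc⟩ := hbC
    exact Or.inr (mem_iUnion₂.2 ⟨c, hc, b, hbc, rfl⟩)
  · refine Or.inl (ContinuousLinearMap.coeFn_injective (Continuous.ext_on hD
      (ContinuousLinearMap.continuous _) (ContinuousLinearMap.continuous _) fun f hf => ?_))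
    refine eq_of_abs_sub_eq_zero (le_antisymm (le_of_forall_pos_lt_add fun ε hε => ?_)
      (abs_nonneg _))
    obtain ⟨n, hn⟩ := exists_nat_one_div_lt hε
    rw [zero_add]
    refine lt_trans (hG f n b hb fun c hc hbc => hbC ⟨c, ?_, hbc⟩) hn
    exact mem_iUnion₂.2 ⟨f, hf, mem_iUnion.2 ⟨n, hc⟩⟩

theorem isAsplundSpace (hT : IsWellFoundedTree T) : IsAsplundSpace C(TreeSpace T, ℝ) := by
  intro Y hY
  let R : StrongDual ℝ C(TreeSpace T, ℝ) →L[ℝ] StrongDual ℝ Y :=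
    ContinuousLinearMap.precomp ℝ Y.subtypeL
  have hR : Function.Surjective R := fun ψ => by
    obtain ⟨φ, hφ, -⟩ := exists_extension_norm_eq Y ψ
    exact ⟨φ, ContinuousLinearMap.ext hφ⟩
  have hcone := hT.induction
    (P := fun t => ((fun b => (ContinuousMap.evalCLM ℝ b).comp Y.subtypeL) '' cone t).Countable)
    fun t => countable_evalCLM_comp_subtypeL_image Y
  have hcount : (range fun b : TreeSpace T => R (ContinuousMap.evalCLM ℝ b)).Countable := by
    refine (countable_iUnion fun t : InitialNode T => hcone t.1).mono ?_
    rintro _ ⟨b, rfl⟩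
    obtain ⟨t, ht, htb⟩ := exists_isMin_mem b
    exact mem_iUnion.2 ⟨⟨t, ht⟩, b, htb, rfl⟩
  let E : Submodule ℝ (StrongDual ℝ C(TreeSpace T, ℝ)) :=
    Submodule.span ℝ (range fun b : TreeSpace T => ContinuousMap.evalCLM ℝ b)
  have hdense : Dense (E : Set (StrongDual ℝ C(TreeSpace T, ℝ))) :=
    (Submodule.dense_iff_topologicalClosure_eq_top).2 (evalSpan_eq_top hT)
  have hdense' : Dense (R '' (E : Set (StrongDual ℝ C(TreeSpace T, ℝ)))) :=
    hR.denseRange.dense_image R.continuous hdense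
  have hsep : TopologicalSpace.IsSeparable (R '' (E : Set (StrongDual ℝ C(TreeSpace T, ℝ)))) := by
    refine (hcount.isSeparable.span (R := ℝ)).mono ?_
    rintro _ ⟨φ, hφ, rfl⟩
    have := Submodule.mem_map_of_mem (f := R.toLinearMap) hφ
    rwa [Submodule.map_span, ← range_comp] at this
  refine TopologicalSpace.isSeparable_univ_iff.1 ?_
  rw [← hdense'.closure_eq]
  exact hsep.closure

end TreeSpace

/-! ### Tree orders on the points of a space -/

/-- `r` is a tree order on the set `A` all of whose cones are clopen. -/
structure IsTreeOrderOn {K : Type u} [TopologicalSpace K] (A : Set K) (r : K → K → Prop) :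
    Prop where
  mem_left : ∀ {x y}, r x y → x ∈ A
  mem_right : ∀ {x y}, r x y → y ∈ A
  refl : ∀ {x}, x ∈ A → r x x
  trans : ∀ {x y z}, r x y → r y z → r x z
  antisymm : ∀ {x y}, r x y → r y x → x = y
  finite : ∀ x, {y | r y x}.Finite
  total : ∀ {x y z}, r x z → r y z → r x y ∨ r y x
  isClopen : ∀ x ∈ A, IsClopen {y | r x y}

/-- The set `A` carries a tree order all of whose cones are clopen. -/
def AdmitsTreeOrder {K : Type u} [TopologicalSpace K] (A : Set K) : Prop :=
  ∃ r : K → K → Prop, IsTreeOrderOn A r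

namespace AdmitsTreeOrder

variable {K : Type u} [TopologicalSpace K]

/-- Points of different pieces are left incomparable, so all cones and predecessor sets are those of
a single piece; no bound on the number of pieces is needed. -/
theorem iUnion {ι : Type*} {V : ι → Set K} (hV : ∀ i, AdmitsTreeOrder (V i))
    (hd : ∀ i j, i ≠ j → Disjoint (V i) (V j)) : AdmitsTreeOrder (⋃ i, V i) := by
  choose r hr using hV
  have huniq : ∀ {i j x}, x ∈ V i → x ∈ V j → i = j := fun {i j x} hi hj =>
    by_contra fun h => disjoint_left.1 (hd i j h) hi hj
  have hup : ∀ {i x}, x ∈ V i → {y | ∃ j, r j x y} = {y | r i x y} := fun {i x} hx => by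
    ext y
    refine ⟨fun ⟨j, hj⟩ => ?_, fun h => ⟨i, h⟩⟩
    obtain rfl := huniq hx ((hr j).mem_left hj)
    exact hj
  have hdown : ∀ {i x}, x ∈ V i → {y | ∃ j, r j y x} = {y | r i y x} := fun {i x} hx => by
    ext y
    refine ⟨fun ⟨j, hj⟩ => ?_, fun h => ⟨i, h⟩⟩
    obtain rfl := huniq hx ((hr j).mem_right hj)
    exact hj
  refine ⟨fun x y => ∃ i, r i x y, ⟨?_, ?_, ?_, ?_, ?_, ?_, ?_, ?_⟩⟩
  · rintro x y ⟨i, h⟩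
    exact mem_iUnion.2 ⟨i, (hr i).mem_left h⟩
  · rintro x y ⟨i, h⟩
    exact mem_iUnion.2 ⟨i, (hr i).mem_right h⟩
  · intro x hx
    obtain ⟨i, hi⟩ := mem_iUnion.1 hx
    exact ⟨i, (hr i).refl hi⟩
  · rintro x y z ⟨i, hi⟩ ⟨j, hj⟩
    obtain rfl := huniq ((hr i).mem_right hi) ((hr j).mem_left hj)
    exact ⟨i, (hr i).trans hi hj⟩
  · rintro x y ⟨i, hi⟩ ⟨j, hj⟩
    obtain rfl := huniq ((hr i).mem_right hi) ((hr j).mem_left hj)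
    exact (hr i).antisymm hi hj
  · intro x
    by_cases hx : ∃ i, x ∈ V i
    · obtain ⟨i, hi⟩ := hx
      rw [hdown hi]
      exact (hr i).finite x
    · refine (finite_empty (α := K)).subset ?_
      rintro y ⟨i, hi⟩
      exact hx ⟨i, (hr i).mem_right hi⟩
  · rintro x y z ⟨i, hi⟩ ⟨j, hj⟩
    obtain rfl := huniq ((hr i).mem_right hi) ((hr j).mem_right hj)
    exact ((hr i).total hi hj).imp (fun h => ⟨i, h⟩) fun h => ⟨i, h⟩
  · intro x hx
    obtain ⟨i, hi⟩ := mem_iUnion.1 hx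
    rw [hup hi]
    exact (hr i).isClopen x hi

/-- Put `p` below everything: the only new cone is the whole set, clopen by `hc`. -/
theorem insert {A : Set K} (hA : AdmitsTreeOrder A) {p : K} (hp : p ∉ A)
    (hc : IsClopen (insert p A)) : AdmitsTreeOrder (insert p A) := by
  obtain ⟨r, hr⟩ := hA
  have hl : ∀ {x}, ¬ r p x := fun h => hp (hr.mem_left h)
  have hright : ∀ {x}, ¬ r x p := fun h => hp (hr.mem_right h)
  refine ⟨fun x y => (x = p ∧ y ∈ Insert.insert p A) ∨ r x y, ⟨?_, ?_, ?_, ?_, ?_, ?_, ?_, ?_⟩⟩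
  · rintro x y (⟨rfl, -⟩ | h)
    exacts [mem_insert _ _, mem_insert_of_mem _ (hr.mem_left h)]
  · rintro x y (⟨-, h⟩ | h)
    exacts [h, mem_insert_of_mem _ (hr.mem_right h)]
  · rintro x (rfl | h)
    exacts [Or.inl ⟨rfl, mem_insert _ _⟩, Or.inr (hr.refl h)]
  · rintro x y z (⟨rfl, h⟩ | h) (⟨rfl, h'⟩ | h')
    exacts [Or.inl ⟨rfl, h'⟩, Or.inl ⟨rfl, mem_insert_of_mem _ (hr.mem_right h')⟩,
      absurd h hright, Or.inr (hr.trans h h')]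
  · rintro x y (⟨rfl, h⟩ | h) (⟨rfl, h'⟩ | h')
    exacts [rfl, absurd h' hright, absurd h hright, hr.antisymm h h']
  · intro x
    refine ((hr.finite x).insert p).subset ?_
    rintro y (⟨rfl, -⟩ | h)
    exacts [mem_insert _ _, mem_insert_of_mem _ h]
  · rintro x y z (⟨rfl, h⟩ | h) (⟨rfl, h'⟩ | h')
    exacts [Or.inl (Or.inl ⟨rfl, mem_insert _ _⟩),
      Or.inl (Or.inl ⟨rfl, mem_insert_of_mem _ (hr.mem_left h')⟩),
      Or.inr (Or.inl ⟨rfl, mem_insert_of_mem _ (hr.mem_left h)⟩),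
      (hr.total h h').imp Or.inr Or.inr]
  · intro x hx
    obtain rfl | hxp := eq_or_ne x p
    · convert hc using 1
      ext y
      simp only [mem_ofPred_eq, true_and, hl, or_false]
    · convert hr.isClopen x (hx.resolve_left hxp) using 1
      ext y
      simp only [mem_ofPred_eq, hxp, false_and, false_or]

/-- A compact Hausdorff space with a tree order all of whose cones are clopen is the tree space of
a well-founded tree. -/
theorem exists_homeomorph [CompactSpace K] (h : AdmitsTreeOrder (univ : Set K)) :
    ∃ (S : Type u) (_ : PartialOrder S), IsOrderTree S ∧ Finite (InitialNode S) ∧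
      IsWellFoundedTree S ∧ Nonempty (TreeSpace S ≃ₜ K) := by
  obtain ⟨r, hr⟩ := h
  let P : PartialOrder K :=
    { le := r
      le_refl := fun x => hr.refl (mem_univ x)
      le_trans := fun _ _ _ => hr.trans
      le_antisymm := fun _ _ => hr.antisymm }
  have hT : IsOrderTree K := ⟨hr.finite, fun t x hx y hy _ => hr.total hx hy⟩
  have hclopen : ∀ x : K, IsClopen (Ici x) := fun x => hr.isClopen x (mem_univ x)
  have hfin : Finite (InitialNode K) := by
    obtain ⟨F, hF⟩ := isCompact_univ.elim_finite_subcover (fun t : InitialNode K => Ici t.1)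
      (fun t => (hclopen t.1).2) (fun x _ => by
        obtain ⟨t, ht, htx⟩ := TreeSpace.exists_isMin_mem (TreeSpace.ofNode x)
        exact mem_iUnion.2 ⟨⟨t, ht⟩, htx⟩)
    refine Set.finite_univ_iff.1 (F.finite_toSet.subset fun t _ => ?_)
    obtain ⟨s, hsF, hst⟩ := mem_iUnion₂.1 (hF (mem_univ t.1))
    obtain rfl : s = t := Subtype.ext (t.2.eq_of_le hst)
    exact hsF
  -- The cones along a branch are nested, non-empty and compact; a common point lies above the whole
  -- branch and has only finitely many predecessors.
  have hwf : IsWellFoundedTree K := fun b => by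
    obtain ⟨x, hx⟩ : (⋂ t : b.1, Ici t.1).Nonempty := by
      have := b.2.nonempty.to_subtype
      refine IsCompact.nonempty_iInter_of_directed_nonempty_isCompact_isClosed _ ?_
        (fun t => ⟨t.1, self_mem_Ici⟩) (fun t => (hclopen t.1).1.isCompact) fun t => (hclopen t.1).1
      intro s t
      obtain hst | hts := b.2.isChain.total s.2 t.2
      · exact ⟨t, Ici_subset_Ici.2 hst, Subset.rfl⟩
      · exact ⟨s, Subset.rfl, Ici_subset_Ici.2 hts⟩
    exact (IsOrderTree.finite_Iic x).subset fun t ht => mem_iInter.1 hx ⟨t, ht⟩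
  have hinj : Function.Injective (TreeSpace.ofNode : K → TreeSpace K) := fun x y hxy =>
    Iic_injective (congrArg Subtype.val hxy)
  have hsurj : Function.Surjective (TreeSpace.ofNode : K → TreeSpace K) := fun b => by
    obtain ⟨m, hm⟩ := (hwf b).exists_maximal b.2.nonempty
    obtain h | ⟨c, hc⟩ := TreeSpace.eq_ofNode_or_mem_cone (show b ∈ TreeSpace.cone m from hm.prop)
    · exact ⟨m, h.symm⟩
    · exact absurd c.2.lt (hm.not_gt hc)
  have hcont : Continuous (TreeSpace.ofNode : K → TreeSpace K) := by
    refine continuous_generateFrom_iff.2 ?_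
    rintro _ ⟨t, rfl | rfl⟩
    exacts [(hclopen t).2, (hclopen t).compl.2]
  exact ⟨K, P, hT, hfin, hwf, ⟨(Continuous.homeoOfEquivCompactToT2
    (f := Equiv.ofBijective _ ⟨hinj, hsurj⟩) hcont).symm⟩⟩

end AdmitsTreeOrder

/-! ### Bad cones and the dyadic tree -/

namespace TreeSpace

variable {T : Type u} [PartialOrder T] [IsOrderTree T]

theorem admitsTreeOrder_cone_diff {t : T} (F : Finset {c // t ⋖ c})
    (h : ∀ c : {c // t ⋖ c}, c ∉ F → AdmitsTreeOrder (cone c.1)) :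
    AdmitsTreeOrder (cone t \ ⋃ c ∈ F, cone c.1) := by
  have hU := AdmitsTreeOrder.iUnion (V := fun c : {c : {c // t ⋖ c} // c ∉ F} => cone c.1.1)
    (fun c => h c.1 c.2) fun c d hcd => disjoint_cone_of_covBy c.1.2 d.1.2 fun h' =>
      hcd (Subtype.ext (Subtype.ext h'))
  have heq : cone t \ ⋃ c ∈ F, cone c.1 =
      insert (ofNode t) (⋃ c : {c : {c // t ⋖ c} // c ∉ F}, cone c.1.1) := by
    ext b
    simp only [mem_sdiff, mem_iUnion, not_exists, mem_insert_iff]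
    constructor
    · rintro ⟨hb, hbF⟩
      exact (eq_ofNode_or_mem_cone hb).imp id fun ⟨c, hc⟩ => ⟨⟨c, fun hcF => hbF c hcF hc⟩, hc⟩
    · rintro (rfl | ⟨c, hc⟩)
      · exact ⟨ofNode_mem_cone t, fun c _ => ofNode_notMem_cone c.2.lt⟩
      · refine ⟨cone_anti c.1.2.le hc, fun d hd hbd => ?_⟩
        exact disjoint_left.1 (disjoint_cone_of_covBy c.1.2 d.2 fun h' =>
          c.2 ((Subtype.ext h' : c.1 = d) ▸ hd)) hc hbd
  rw [heq]
  refine hU.insert ?_ ?_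
  · simp only [mem_iUnion, not_exists]
    exact fun c => ofNode_notMem_cone c.1.2.lt
  · rw [← heq]
    exact (isClopen_cone t).diff (F.finite_toSet.isClopen_biUnion fun c _ => isClopen_cone c.1)

/-- The successive differences exhaust the cone of `f 0` except for the one branch through all `f
n`, which becomes the new root. -/
theorem admitsTreeOrder_cone_of_seq {f : ℕ → T} (hf : StrictMono f)
    (h : ∀ n, AdmitsTreeOrder (cone (f n) \ cone (f (n + 1)))) : AdmitsTreeOrder (cone (f 0)) := by
  have hlt : ∀ m n, m < n → Disjoint (cone (f m) \ cone (f (m + 1)))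
      (cone (f n) \ cone (f (n + 1))) := fun m n hmn =>
    disjoint_left.2 fun b hm hn => hm.2 (cone_anti (hf.monotone hmn) hn.1)
  have hU := AdmitsTreeOrder.iUnion h fun m n hmn =>
    (lt_or_gt_of_ne hmn).elim (hlt m n) fun h' => (hlt n m h').symm
  let p : TreeSpace T := ⟨{s | ∃ n, s ≤ f n}, isBranch_of_monotone hf.monotone⟩
  have hp : ∀ n, p ∈ cone (f n) := fun n => ⟨n, le_rfl⟩
  have heq : cone (f 0) = insert p (⋃ n, cone (f n) \ cone (f (n + 1))) := by
    ext b
    simp only [mem_insert_iff, mem_iUnion, mem_sdiff]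
    constructor
    · intro hb
      by_cases h' : ∃ n, b ∈ cone (f n) ∧ b ∉ cone (f (n + 1))
      · exact Or.inr h'
      · refine Or.inl (eq_of_forall_mem hf fun n => ?_)
        induction n with
        | zero => exact hb
        | succ n ih => exact by_contra fun hn => h' ⟨n, ih, hn⟩
    · rintro (rfl | ⟨n, hn, -⟩)
      exacts [hp 0, cone_anti (hf.monotone (Nat.zero_le n)) hn]
  rw [heq]
  refine hU.insert ?_ (heq ▸ isClopen_cone _)
  simp only [mem_iUnion, mem_sdiff, not_exists, not_and_not_right]
  exact fun n _ => hp (n + 1)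

theorem exists_incomparable_of_not_admitsTreeOrder {t : T} (ht : ¬ AdmitsTreeOrder (cone t)) :
    ∃ s₁ s₂ : T, t ≤ s₁ ∧ t ≤ s₂ ∧ ¬ s₁ ≤ s₂ ∧ ¬ s₂ ≤ s₁ ∧
      ¬ AdmitsTreeOrder (cone s₁) ∧ ¬ AdmitsTreeOrder (cone s₂) := by
  classical
  by_contra! hcomp
  have hchild : ∀ s : {s // t ≤ s ∧ ¬ AdmitsTreeOrder (cone s)},
      ∃ c : {s // t ≤ s ∧ ¬ AdmitsTreeOrder (cone s)}, s.1 ⋖ c.1 := fun s => by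
    by_contra! hs
    refine s.2.2 ?_
    -- With nothing removed: a node whose children are all good is itself good.
    simpa using admitsTreeOrder_cone_diff (t := s.1) ∅ fun c _ => by_contra fun hc =>
      hs ⟨c.1, s.2.1.trans c.2.le, hc⟩ c.2
  choose g hg using hchild
  let f : ℕ → {s // t ≤ s ∧ ¬ AdmitsTreeOrder (cone s)} := fun n => g^[n] ⟨t, le_rfl, ht⟩
  have hcov : ∀ n, (f n).1 ⋖ (f (n + 1)).1 := fun n => by
    simpa only [f, Function.iterate_succ_apply'] using hg (f n)
  refine ht (admitsTreeOrder_cone_of_seq (f := fun n => (f n).1)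
    (strictMono_nat_of_lt_succ fun n => (hcov n).lt) fun n => ?_)
  -- A bad child of `f n` other than `f (n + 1)` would be incomparable to it, which `hcomp`
  -- excludes.
  have := admitsTreeOrder_cone_diff (t := (f n).1) {⟨(f (n + 1)).1, hcov n⟩} fun c hc => by
    by_contra hbad
    have hne : c.1 ≠ (f (n + 1)).1 := fun h =>
      hc (Finset.mem_singleton.2 (Subtype.ext h))
    by_cases h₁ : c.1 ≤ (f (n + 1)).1
    · exact (hcov n).2 c.2.lt (h₁.lt_of_ne hne)
    by_cases h₂ : (f (n + 1)).1 ≤ c.1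
    · exact c.2.2 (hcov n).lt (h₂.lt_of_ne hne.symm)
    exact (f (n + 1)).2.2 (hcomp c.1 (f (n + 1)).1 ((f n).2.1.trans c.2.le) (f (n + 1)).2.1
      h₁ h₂ hbad)
  simpa using this

theorem exists_not_admitsTreeOrder_cone (h : ¬ AdmitsTreeOrder (univ : Set (TreeSpace T))) :
    ∃ t : T, ¬ AdmitsTreeOrder (cone t) := by
  by_contra! h'
  refine h ?_
  have := AdmitsTreeOrder.iUnion (V := fun t : InitialNode T => cone t.1) (fun t => h' t.1)
    fun s t hst => disjoint_cone (fun hle => hst (Subtype.ext (t.2.eq_of_le hle)))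
      fun hle => hst (Subtype.ext (s.2.eq_of_le hle).symm)
  convert this using 1
  refine (eq_univ_of_forall fun b => ?_).symm
  obtain ⟨t, ht, htb⟩ := exists_isMin_mem b
  exact mem_iUnion.2 ⟨⟨t, ht⟩, htb⟩

/-- Without an admissible tree order, the tree contains a dyadic tree. -/
theorem exists_dyadic (h : ¬ AdmitsTreeOrder (univ : Set (TreeSpace T))) :
    ∃ φ : List Bool → T, (∀ l a, φ l ≤ φ (a :: l)) ∧
      ∀ l a b, a ≠ b → ¬ φ (a :: l) ≤ φ (b :: l) := by
  obtain ⟨t, ht⟩ := exists_not_admitsTreeOrder_cone h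
  have hsplit : ∀ s : {s : T // ¬ AdmitsTreeOrder (cone s)},
      ∃ g : Bool → {s : T // ¬ AdmitsTreeOrder (cone s)},
        (∀ a, s.1 ≤ (g a).1) ∧ ∀ a b, a ≠ b → ¬ (g a).1 ≤ (g b).1 := fun s => by
    obtain ⟨s₁, s₂, h₁, h₂, h₁₂, h₂₁, hs₁, hs₂⟩ := exists_incomparable_of_not_admitsTreeOrder s.2
    refine ⟨fun a => if a then ⟨s₁, hs₁⟩ else ⟨s₂, hs₂⟩, ?_, ?_⟩
    · rintro (_ | _) <;> simpa
    · rintro (_ | _) (_ | _) hab <;> simp_all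
  choose g hg hg' using hsplit
  let φ : List Bool → {s : T // ¬ AdmitsTreeOrder (cone s)} := fun l =>
    l.rec ⟨t, ht⟩ fun a _ s => g s a
  exact ⟨fun l => (φ l).1, fun l a => hg (φ l) a, fun l a b hab => hg' (φ l) a b hab⟩

end TreeSpace

/-! ### Asplund spaces exclude the dyadic tree -/

theorem countable_of_one_le_dist {ι X : Type*} [PseudoMetricSpace X]
    [TopologicalSpace.SeparableSpace X] {f : ι → X} (hf : ∀ i j, i ≠ j → 1 ≤ dist (f i) (f j)) :
    Countable ι := by
  refine countable_univ_iff.1 (Set.PairwiseDisjoint.countable_of_isOpen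
    (s := fun i => Metric.ball (f i) (1 / 2)) (fun i _ j _ hij => ?_)
    (fun i _ => Metric.isOpen_ball) fun i _ => Metric.nonempty_ball.2 one_half_pos)
  exact Metric.ball_disjoint_ball (by linarith [hf i j hij])

/-- The span of `D` is separable, hence so is its dual, where the restrictions of the `δ i` are at
mutual distance at least 1. -/
theorem IsAsplundSpace.countable_of_separated {X : Type u} [NormedAddCommGroup X] [NormedSpace ℝ X]
    (hX : IsAsplundSpace X) {D : Set X} (hD : D.Countable) {ι : Type*} (δ : ι → StrongDual ℝ X)
    (hδ : ∀ i j, i ≠ j → ∃ f ∈ D, ‖f‖ ≤ 1 ∧ 1 ≤ ‖δ i f - δ j f‖) : Countable ι := by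
  have hY : TopologicalSpace.SeparableSpace (Submodule.span ℝ D) :=
    (hD.isSeparable.span (R := ℝ)).separableSpace
  have := hX _ hY
  let ψ : ι → StrongDual ℝ (Submodule.span ℝ D) := fun i =>
    (δ i).comp (Submodule.span ℝ D).subtypeL
  refine countable_of_one_le_dist (f := ψ) fun i j hij => ?_
  obtain ⟨f, hfD, hf, hle⟩ := hδ i j hij
  have hnorm : ‖δ i f - δ j f‖ ≤ ‖ψ i - ψ j‖ :=
    ((ψ i - ψ j).le_opNorm ⟨f, Submodule.subset_span hfD⟩).trans
      (mul_le_of_le_one_right (norm_nonneg _) hf)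
  exact (hle.trans hnorm).trans_eq (dist_eq_norm (ψ i) (ψ j)).symm

namespace TreeSpace

variable {T : Type u} [PartialOrder T] [IsOrderTree T] [Finite (InitialNode T)]

theorem admitsTreeOrder_univ (h : IsAsplundSpace C(TreeSpace T, ℝ)) :
    AdmitsTreeOrder (univ : Set (TreeSpace T)) := by
  by_contra hbad
  obtain ⟨φ, hle, hnle⟩ := exists_dyadic hbad
  -- The latest bit stands at the head, so `path σ (n + 1)` is a child of `path σ n` in the indexing
  -- of `φ`.
  let path : (ℕ → Bool) → ℕ → List Bool := fun σ n => n.rec [] fun k l => σ k :: l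
  have hmono : ∀ σ, Monotone fun n => φ (path σ n) := fun σ =>
    monotone_nat_of_le_succ fun n => hle (path σ n) (σ n)
  let x : (ℕ → Bool) → TreeSpace T := fun σ => ⟨_, isBranch_of_monotone (hmono σ)⟩
  have hx : ∀ σ n, x σ ∈ cone (φ (path σ n)) := fun σ n => ⟨n, le_rfl⟩
  have hsep : ∀ σ τ, σ ≠ τ → ∃ f ∈ range fun l => (isClopen_cone (φ l)).ind, ‖f‖ ≤ 1 ∧
      1 ≤ ‖f (x σ) - f (x τ)‖ := by
    intro σ τ hστ
    obtain ⟨n, hn, hmin⟩ : ∃ n, σ n ≠ τ n ∧ ∀ m < n, σ m = τ m := by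
      have hex : ∃ n, σ n ≠ τ n := Function.ne_iff.1 hστ
      classical
      exact ⟨Nat.find hex, Nat.find_spec hex, fun m hm => not_not.1 (Nat.find_min hex hm)⟩
    have hpath : ∀ m ≤ n, path σ m = path τ m := fun m hm => by
      induction m with
      | zero => rfl
      | succ m ih =>
        change σ m :: path σ m = τ m :: path τ m
        rw [ih (Nat.le_of_succ_le hm), hmin m hm]
    -- At the first difference `n`, the two nodes of level `n + 1` are incomparable, so no branch
    -- contains both.
    have hτ : x τ ∉ cone (φ (path σ (n + 1))) := fun h' => by
      have htot := (x τ).2.isChain.total h' (hx τ (n + 1))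
      change φ (σ n :: path σ n) ≤ φ (τ n :: path τ n) ∨
        φ (τ n :: path τ n) ≤ φ (σ n :: path σ n) at htot
      rw [hpath n le_rfl] at htot
      exact htot.elim (hnle _ _ _ hn) (hnle _ _ _ hn.symm)
    refine ⟨_, ⟨path σ (n + 1), rfl⟩, (ContinuousMap.norm_le _ zero_le_one).2 fun b => ?_, ?_⟩
    · by_cases hb : b ∈ cone (φ (path σ (n + 1)))
      · rw [IsClopen.ind_of_mem _ hb, norm_one]
      · rw [IsClopen.ind_of_notMem _ hb, norm_zero]
        exact zero_le_one
    · rw [IsClopen.ind_of_mem _ (hx σ (n + 1)), IsClopen.ind_of_notMem _ hτ, sub_zero, norm_one]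
  have hcount : Countable (ℕ → Bool) := 
    h.countable_of_separated (countable_range _) (fun σ => ContinuousMap.evalCLM ℝ (x σ)) hsep
  obtain ⟨e, he⟩ := exists_surjective_nat (ℕ → Bool)
  -- Cantor's diagonal sequence.
  obtain ⟨n, hn⟩ := he fun n => !(e n n)
  exact Bool.not_ne_self _ (congrFun hn n).symm

end TreeSpace

theorem mainTheorem5 {T : Type u} [PartialOrder T] [IsOrderTree T] [Finite (InitialNode T)] :
    (IsWellFoundedTree T → IsAsplundSpace C(TreeSpace T, ℝ)) ∧
    (IsAsplundSpace C(TreeSpace T, ℝ) →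
      ∃ (S : Type u) (_ : PartialOrder S), IsOrderTree S ∧ Finite (InitialNode S) ∧
        IsWellFoundedTree S ∧ Nonempty (TreeSpace S ≃ₜ TreeSpace T)) := by
  exact ⟨TreeSpace.isAsplundSpace, fun h => (TreeSpace.admitsTreeOrder_univ h).exists_homeomorph⟩
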